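/- For $n\ge 0$ let $\ell:\mathbb F_2^n\to\mathbb R$, $\ell(x)=\sum_{i=1}^n x_i$ (the bits $x_i\in\{0,1\}$ being summed as real numbers), be the OneMax function. For $i\ne j$ in $\{1,\dots,n\}$ let $\tau_{ij}=I_n+B_{ij}$ be the elementary transvection over $\mathbb F_2$, where $B_{ij}$ is the $n\times n$ matrix with $(i,j)$ entry $1$ and all other entries $0$. For $t\ge 1$ let $G_t$ be the set of all products of exactly $t$ elementary transvections of $\mathbb F_2^n$, and let $\mathcal F_t$ be the class of all functions $x\mapsto \ell(Mx+b)$ with $M\in G_t$ and $b\in\mathbb F_2^n$ (sums and products in $Mx+b$ being computed in $\mathbb F_2$). The black box complexity of a class $\mathcal F$ of functions $\mathbb F_2^n\to\mathbb R$ is $$B_{\mathcal F}=\inf_{A}\ \sup_{f\in\mathcal F}\ \mathbb E\,(T(A,f)),$$ where $A$ ranges over all (unrestricted) randomized search algorithms, i.e. each query of $A$ is an arbitrary function of a random seed and of the previously queried points and their values, and $T(A,f)\in\{1,2,\dots\}\cup\{\infty\}$ is the number of evaluations of $f$ made by $A$ up to and including the first evaluation at a maximal point of $f$. Theorem. For every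 positive integer $t$, as $n\to\infty$, $$B_{\mathcal F_t}=O(n^{2t-1})\ \text{ if } t\le 5,\qquad B_{\mathcal F_t}=O(n^{10}\log^2 n)\ \text{ if } t>5,$$ where the constants implied by $O$ are absolute: they depend neither on $n$ nor on $t$. -/

import Mathlib

open MeasureTheory
open scoped ENNReal Matrix

/-- Bit vectors of length `n`, seen as vectors over the field with two elements. -/
abbrev BitVector (n : ℕ) : Type := Fin n → ZMod 2

/-- OneMax: the number of ones of a bit vector, as a real number. -/
def oneMax {n : ℕ} (x : BitVector n) : ℝ := ∑ i, ((x i).val : ℝ)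

/-- `transvectionProducts n t` is the set of all products of exactly `t` elementary transvections
`I + B i j` (with `i ≠ j`) over the field with two elements. -/
def transvectionProducts (n t : ℕ) : Set (Matrix (Fin n) (Fin n) (ZMod 2)) :=
  {M | ∃ L : List (Matrix (Fin n) (Fin n) (ZMod 2)),
    L.length = t ∧
    (∀ τ ∈ L, ∃ i j : Fin n, i ≠ j ∧ τ = Matrix.transvection i j 1) ∧
    L.prod = M}

/-- The class of functions `x ↦ oneMax (M x + b)`, where `M` is a product of `t` elementary
transvections and `b` is any bit vector. -/
def tsAffineOneMax (n t : ℕ) : Set (BitVector n → ℝ) :=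
  {f | ∃ M ∈ transvectionProducts n t, ∃ b : BitVector n,
    f = fun x => oneMax (M *ᵥ x + b)}

/-- The list of the first `k` evaluations (queried point, value of `f` there), oldest first,
of the deterministic search strategy `q` on the function `f`. The strategy maps the list of
past evaluations to the next point to evaluate. -/
def evaluations {n : ℕ} (q : List (BitVector n × ℝ) → BitVector n) (f : BitVector n → ℝ) :
    ℕ → List (BitVector n × ℝ)
  | 0 => []
  | k + 1 => evaluations q f k ++ [(q (evaluations q f k), f (q (evaluations q f k)))]

/-- The runtime of the strategy `q` on `f`: the number of evaluations up to and including the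
first one at a maximal point of `f` (and `∞` if no maximal point is ever evaluated).
The point evaluated in evaluation number `k + 1` is `q (evaluations q f k)`. -/
noncomputable def runtime {n : ℕ} (q : List (BitVector n × ℝ) → BitVector n)
    (f : BitVector n → ℝ) : ℝ≥0∞ :=
  ⨅ (k : ℕ) (_ : ∀ y, f y ≤ f (q (evaluations q f k))), ((k + 1 : ℕ) : ℝ≥0∞)

/-- An (unrestricted) randomized search algorithm: it draws a random seed `ω` from a probability
space, and every query is a function of the seed and of the evaluations made so far. -/
structure RandomizedSearch (n : ℕ) where
  Seed : Type
  measurableSpace : MeasurableSpace Seed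
  law : Measure Seed
  isProbabilityMeasure : IsProbabilityMeasure law
  query : Seed → List (BitVector n × ℝ) → BitVector n
  measurableSet_query : ∀ h x, MeasurableSet {ω | query ω h = x}

/-- The expected runtime of a randomized search algorithm on `f`. -/
noncomputable def RandomizedSearch.expectedRuntime {n : ℕ} (A : RandomizedSearch n)
    (f : BitVector n → ℝ) : ℝ≥0∞ :=
  letI := A.measurableSpace
  ∫⁻ ω, runtime (A.query ω) f ∂A.law

/-- The unrestricted black box complexity of a class of functions: the infimum over all randomized
search algorithms of the worst expected runtime on the class. -/
noncomputable def blackBoxComplexity {n : ℕ} (𝓕 : Set (BitVector n → ℝ)) : ℝ≥0∞ :=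
  ⨅ A : RandomizedSearch n, ⨆ f ∈ 𝓕, A.expectedRuntime f

/-! ### Query strategies and the reduction to counting candidates. -/

section Strategy

variable {n : ℕ}

/-! Only evaluations are charged, so it suffices that few fixed points identify the function; a
maximal point is then computed for free. Expanded in characters of `𝔽₂ⁿ`, each `oneMax (M x + b)` is
a constant minus `n` signed halves of characters, one per row of `M`. A difference of two such
functions thus involves at most `2 * n` characters, and an uncertainty principle
(`two_pow_le_card_mul_card_support`) makes it, if nonzero, nonzero on a fraction at least `1 / (2 *
n)` of the cube. There are at most `2 ^ (4 * n ^ 2)` pairs, so by a union bound some `8 * n ^ 3`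
points separate all of them (`exists_separating_points`).

This cubic bound holds for every `t`, and suffices once `2 * t - 1 ≥ 3`. For `t = 1` a linear bound
is needed: the values at `0` and at the unit vectors reveal `j` and `b`, leaving at most `n` choices
of `i` to try. -/

theorem length_evaluations (q : List (BitVector n × ℝ) → BitVector n) (f : BitVector n → ℝ)
    (k : ℕ) : (evaluations q f k).length = k := by
  induction k with
  | zero => rfl
  | succ k ih => simp [evaluations, ih]

/-- The evaluations of `f` at the first `m` points of the sequence `Q`. -/
def transcript (Q : ℕ → BitVector n) (m : ℕ) (f : BitVector n → ℝ) : List (BitVector n × ℝ) :=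
  (List.range m).map fun k => (Q k, f (Q k))

theorem length_transcript (Q : ℕ → BitVector n) (m : ℕ) (f : BitVector n → ℝ) :
    (transcript Q m f).length = m := by
  simp [transcript]

/-- The strategy that first evaluates the first `m` points of `Q`, and then the points of a
sequence chosen according to the outcome. -/
def twoPhase (Q : ℕ → BitVector n) (m : ℕ) (cand : List (BitVector n × ℝ) → ℕ → BitVector n)
    (h : List (BitVector n × ℝ)) : BitVector n :=
  if h.length < m then Q h.length else cand (h.take m) (h.length - m)

theorem evaluations_twoPhase_of_le (Q : ℕ → BitVector n) (m : ℕ)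
    (cand : List (BitVector n × ℝ) → ℕ → BitVector n) (f : BitVector n → ℝ) {k : ℕ}
    (hk : k ≤ m) : evaluations (twoPhase Q m cand) f k = transcript Q k f := by
  induction k with
  | zero => rfl
  | succ k ih =>
    have hq : twoPhase Q m cand (transcript Q k f) = Q k := by
      simp [twoPhase, length_transcript, Nat.lt_of_succ_le hk]
    rw [evaluations, ih (by omega), hq]
    simp [transcript, List.range_succ]

/-- Later evaluations leave the first `m` entries intact, so the second phase keeps working through
one and the same candidate sequence. -/
theorem take_evaluations_twoPhase (Q : ℕ → BitVector n) (m : ℕ)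
    (cand : List (BitVector n × ℝ) → ℕ → BitVector n) (f : BitVector n → ℝ) (k : ℕ) :
    (evaluations (twoPhase Q m cand) f (m + k)).take m = transcript Q m f := by
  induction k with
  | zero =>
    rw [add_zero, evaluations_twoPhase_of_le Q m cand f le_rfl]
    exact List.take_of_length_le (length_transcript Q m f).le
  | succ k ih =>
    rw [← add_assoc, evaluations, List.take_append_of_le_length, ih]
    rw [length_evaluations]
    omega

theorem runtime_le {q : List (BitVector n × ℝ) → BitVector n} {f : BitVector n → ℝ} {k : ℕ}
    (h : ∀ y, f y ≤ f (q (evaluations q f k))) : runtime q f ≤ ((k + 1 : ℕ) : ℝ≥0∞) :=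
  iInf₂_le k h

/-- A deterministic strategy, seen as a randomized search algorithm. -/
noncomputable def RandomizedSearch.ofStrategy (q : List (BitVector n × ℝ) → BitVector n) :
    RandomizedSearch n where
  Seed := Unit
  measurableSpace := ⊤
  law := @Measure.dirac Unit ⊤ ()
  isProbabilityMeasure := @Measure.dirac.isProbabilityMeasure Unit ⊤ ()
  query _ := q
  measurableSet_query _ _ := trivial

theorem RandomizedSearch.expectedRuntime_ofStrategy
    (q : List (BitVector n × ℝ) → BitVector n) (f : BitVector n → ℝ) :
    (RandomizedSearch.ofStrategy q).expectedRuntime f = runtime q f := by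
  change (@lintegral Unit ⊤ (@Measure.dirac Unit ⊤ ()) fun _ => runtime q f) = runtime q f
  rw [lintegral_const, measure_univ, mul_one]

theorem blackBoxComplexity_le_of_strategy {𝓕 : Set (BitVector n → ℝ)} {B : ℝ≥0∞}
    (q : List (BitVector n × ℝ) → BitVector n) (h : ∀ f ∈ 𝓕, runtime q f ≤ B) :
    blackBoxComplexity 𝓕 ≤ B :=
  (iInf_le _ (RandomizedSearch.ofStrategy q)).trans <| iSup₂_le fun f hf => by
    rw [RandomizedSearch.expectedRuntime_ofStrategy]
    exact h f hf

/-- If the values at `m` fixed points leave only `N` candidates for a maximal point, then the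
black box complexity is at most `m + N`. -/
theorem blackBoxComplexity_le_add {𝓕 : Set (BitVector n → ℝ)} (Q : ℕ → BitVector n) (m N : ℕ)
    (h : ∀ f ∈ 𝓕, ∃ c : ℕ → BitVector n, ∀ g ∈ 𝓕, (∀ k < m, f (Q k) = g (Q k)) →
      ∃ k < N, ∀ y, g y ≤ g (c k)) :
    blackBoxComplexity 𝓕 ≤ ((m + N : ℕ) : ℝ≥0∞) := by
  classical
  choose! c hc using h
  -- Any class member with the observed transcript may serve as representative; the default `0` only
  -- covers transcripts that no member produces.
  let cand : List (BitVector n × ℝ) → ℕ → BitVector n := fun l =>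
    if hl : ∃ f ∈ 𝓕, transcript Q m f = l then c hl.choose else fun _ => 0
  refine blackBoxComplexity_le_of_strategy (twoPhase Q m cand) fun g hg => ?_
  obtain ⟨k, hk, hmax⟩ : ∃ k < N, ∀ y, g y ≤ g (cand (transcript Q m g) k) := by
    have hl : ∃ f ∈ 𝓕, transcript Q m f = transcript Q m g := ⟨g, hg, rfl⟩
    simp only [cand, dif_pos hl]
    refine hc _ hl.choose_spec.1 g hg fun k hk => ?_
    have := List.map_inj_left.1 hl.choose_spec.2 k (List.mem_range.2 hk)
    exact congrArg Prod.snd this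
  have hq : twoPhase Q m cand (evaluations (twoPhase Q m cand) g (m + k)) =
      cand (transcript Q m g) k := by
    conv_lhs => rw [twoPhase]
    simp [length_evaluations, take_evaluations_twoPhase]
  refine (runtime_le (k := m + k) (by rw [hq]; exact hmax)).trans ?_
  exact_mod_cast (by omega : m + k + 1 ≤ m + N)

end Strategy

/-! ### Fourier expansion and the uncertainty principle. -/

section Characters

variable {n : ℕ}

/-- The nontrivial real character of the field with two elements. -/
def bitSign (u : ZMod 2) : ℝ := if u = 0 then 1 else -1

theorem eq_zero_or_one : ∀ u : ZMod 2, u = 0 ∨ u = 1 := by decide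

theorem bitSign_zero : bitSign 0 = 1 := by simp [bitSign]

theorem bitSign_one : bitSign 1 = -1 := by simp [bitSign]

theorem bitSign_add (u v : ZMod 2) : bitSign (u + v) = bitSign u * bitSign v := by
  have h : (1 + 1 : ZMod 2) = 0 := rfl
  rcases eq_zero_or_one u with rfl | rfl <;> rcases eq_zero_or_one v with rfl | rfl <;>
    simp [bitSign, h]

theorem abs_bitSign (u : ZMod 2) : |bitSign u| = 1 := by
  unfold bitSign; split_ifs <;> simp

theorem val_eq_bitSign (u : ZMod 2) : (u.val : ℝ) = (1 - bitSign u) / 2 := by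
  rcases eq_zero_or_one u with rfl | rfl
  · simp [bitSign]
  · simp [bitSign, ZMod.val_one]

theorem sum_bitSign_dotProduct {a : BitVector n} (ha : a ≠ 0) :
    ∑ x : BitVector n, bitSign (a ⬝ᵥ x) = 0 := by
  obtain ⟨i, hi⟩ := Function.ne_iff.1 ha
  have hi1 : a i = 1 := (eq_zero_or_one _).resolve_left hi
  have h : ∑ x : BitVector n, bitSign (a ⬝ᵥ x) = ∑ x : BitVector n, -bitSign (a ⬝ᵥ x) := by
    -- Translation by a unit vector in the support of `a` flips the sign of the character.
    rw [← Equiv.sum_comp (Equiv.addRight (Pi.single i (1 : ZMod 2) : BitVector n))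
      fun x => bitSign (a ⬝ᵥ x)]
    refine Finset.sum_congr rfl fun x _ => ?_
    simp [dotProduct_add, bitSign_add, hi1, bitSign_one]
  rw [Finset.sum_neg_distrib] at h
  linarith

theorem sum_bitSign_mul_bitSign (a a' : BitVector n) :
    ∑ x : BitVector n, bitSign (a ⬝ᵥ x) * bitSign (a' ⬝ᵥ x) = if a = a' then 2 ^ n else 0 := by
  simp only [← bitSign_add, ← add_dotProduct]
  split_ifs with h
  · subst h
    have h2 : a + a = 0 := funext fun i => CharTwo.add_self_eq_zero (a i)
    simp [h2, bitSign_zero]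
  · exact sum_bitSign_dotProduct fun h0 =>
      h (funext fun i => CharTwo.add_eq_zero.1 (congrFun h0 i))

/-- A nonzero combination of `s` characters of `𝔽₂ⁿ` is nonzero on at least `2 ^ n / s` points. -/
theorem two_pow_le_card_mul_card_support (S : Finset (BitVector n)) (c : BitVector n → ℝ)
    (g : BitVector n → ℝ) (hg : ∀ x, g x = ∑ a ∈ S, c a * bitSign (a ⬝ᵥ x)) (h0 : g ≠ 0) :
    2 ^ n ≤ S.card * (Finset.univ.filter fun x => g x ≠ 0).card := by
  obtain ⟨y, hy⟩ := Finite.exists_max fun x => |g x|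
  have hpos : 0 < |g y| := by
    obtain ⟨z, hz⟩ := Function.ne_iff.1 h0
    exact (abs_pos.2 hz).trans_le (hy z)
  -- Convolution with the kernel `∑ a' ∈ S` reproduces `g`. The kernel is bounded by `S.card`, so
  -- evaluating at a maximum of `|g|` bounds the support from below.
  have hrep : 2 ^ n * g y =
      ∑ x, g x * ∑ a' ∈ S, bitSign (a' ⬝ᵥ x) * bitSign (a' ⬝ᵥ y) := by
    calc 2 ^ n * g y
        = ∑ a ∈ S, ∑ a' ∈ S, c a * bitSign (a' ⬝ᵥ y) *
            ∑ x : BitVector n, bitSign (a ⬝ᵥ x) * bitSign (a' ⬝ᵥ x) := by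
          simp only [sum_bitSign_mul_bitSign, mul_ite, mul_zero, hg y, Finset.mul_sum]
          refine Finset.sum_congr rfl fun a ha => ?_
          rw [Finset.sum_ite_eq, if_pos ha]
          ring
      _ = ∑ a ∈ S, ∑ a' ∈ S, ∑ x : BitVector n,
            c a * bitSign (a ⬝ᵥ x) * (bitSign (a' ⬝ᵥ x) * bitSign (a' ⬝ᵥ y)) := by
          simp only [Finset.mul_sum]
          refine Finset.sum_congr rfl fun a _ => Finset.sum_congr rfl fun a' _ =>
            Finset.sum_congr rfl fun x _ => by ring
      _ = ∑ x : BitVector n, ∑ a ∈ S, ∑ a' ∈ S,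
            c a * bitSign (a ⬝ᵥ x) * (bitSign (a' ⬝ᵥ x) * bitSign (a' ⬝ᵥ y)) := by
          rw [Finset.sum_comm (s := Finset.univ)]
          exact Finset.sum_congr rfl fun a _ => Finset.sum_comm
      _ = _ := by
          refine Finset.sum_congr rfl fun x _ => ?_
          rw [hg x, Finset.sum_mul_sum]
  have hker (x : BitVector n) :
      |∑ a' ∈ S, bitSign (a' ⬝ᵥ x) * bitSign (a' ⬝ᵥ y)| ≤ S.card := by
    refine (Finset.abs_sum_le_sum_abs _ _).trans ?_
    simp [abs_mul, abs_bitSign]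
  have hbound : 2 ^ n * |g y| ≤
      (S.card * (Finset.univ.filter fun x => g x ≠ 0).card : ℕ) * |g y| := by
    calc 2 ^ n * |g y| = |2 ^ n * g y| := by rw [abs_mul, abs_of_pos (by positivity : (0 : ℝ) < 2 ^ n)]
      _ ≤ ∑ x, |g x * ∑ a' ∈ S, bitSign (a' ⬝ᵥ x) * bitSign (a' ⬝ᵥ y)| := by
          rw [hrep]; exact Finset.abs_sum_le_sum_abs _ _
      _ ≤ ∑ x, if g x ≠ 0 then |g y| * S.card else 0 := by
          refine Finset.sum_le_sum fun x _ => ?_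
          split_ifs with hx
          · rw [abs_mul]
            exact mul_le_mul (hy x) (hker x) (abs_nonneg _) (abs_nonneg _)
          · simp [not_not.1 hx]
      _ = _ := by
          rw [← Finset.sum_filter, Finset.sum_const, nsmul_eq_mul]
          push_cast
          ring
  exact_mod_cast le_of_mul_le_mul_right hbound hpos

theorem oneMax_eq_bitSign (x : BitVector n) : oneMax x = n / 2 - ∑ i, bitSign (x i) / 2 := by
  simp only [oneMax, val_eq_bitSign, sub_div, Finset.sum_sub_distrib, Finset.sum_const,
    Finset.card_univ, Fintype.card_fin, nsmul_eq_mul]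
  ring

/-- The function `x ↦ oneMax (M x + b)`. -/
def affineOneMax (M : Matrix (Fin n) (Fin n) (ZMod 2)) (b : BitVector n) : BitVector n → ℝ :=
  fun x => oneMax (M *ᵥ x + b)

/-- The rows of `M` are the frequencies; `b` affects only the signs of the coefficients. -/
theorem affineOneMax_eq_bitSign (M : Matrix (Fin n) (Fin n) (ZMod 2)) (b x : BitVector n) :
    affineOneMax M b x = n / 2 - ∑ i, bitSign (b i) / 2 * bitSign (M i ⬝ᵥ x) := by
  rw [affineOneMax, oneMax_eq_bitSign]
  congr 1
  refine Finset.sum_congr rfl fun i _ => ?_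
  rw [Pi.add_apply, bitSign_add, Matrix.mulVec]
  ring

/-- Grouping equal characters. -/
theorem sum_mul_bitSign_eq_sum_image (M : Matrix (Fin n) (Fin n) (ZMod 2)) (d : Fin n → ℝ)
    {S : Finset (BitVector n)} (hS : ∀ i, M i ∈ S) (x : BitVector n) :
    ∑ i, d i * bitSign (M i ⬝ᵥ x) =
      ∑ a ∈ S, (∑ i, if M i = a then d i else 0) * bitSign (a ⬝ᵥ x) := by
  simp only [Finset.sum_mul]
  rw [Finset.sum_comm]
  refine Finset.sum_congr rfl fun i _ => ?_
  simp [ite_mul, hS i]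

/-- Two distinct functions of the form `x ↦ oneMax (M x + b)` differ on a fraction of at least
`1 / (2 * n)` of all points. -/
theorem two_pow_le_card_affineOneMax_ne {M M' : Matrix (Fin n) (Fin n) (ZMod 2)}
    {b b' : BitVector n} (h : affineOneMax M b ≠ affineOneMax M' b') :
    2 ^ n ≤ 2 * n *
      (Finset.univ.filter fun x => affineOneMax M b x ≠ affineOneMax M' b' x).card := by
  classical
  set S : Finset (BitVector n) :=
    Finset.univ.image (fun i => M i) ∪ Finset.univ.image (fun i => M' i)
  have hcard : S.card ≤ 2 * n := by
    refine (Finset.card_union_le _ _).trans ?_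
    have h1 := Finset.card_image_le (s := Finset.univ) (f := fun i => M i)
    have h2 := Finset.card_image_le (s := Finset.univ) (f := fun i => M' i)
    simp only [Finset.card_univ, Fintype.card_fin] at h1 h2
    omega
  have hM : ∀ i, M i ∈ S := fun i =>
    Finset.mem_union_left _ (Finset.mem_image_of_mem (fun i => M i) (Finset.mem_univ i))
  have hM' : ∀ i, M' i ∈ S := fun i =>
    Finset.mem_union_right _ (Finset.mem_image_of_mem (fun i => M' i) (Finset.mem_univ i))
  have key := two_pow_le_card_mul_card_support S
    (fun a => (∑ i, if M' i = a then bitSign (b' i) / 2 else 0) -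
      ∑ i, if M i = a then bitSign (b i) / 2 else 0)
    (fun x => affineOneMax M b x - affineOneMax M' b' x)
    (fun x => by
      rw [affineOneMax_eq_bitSign, affineOneMax_eq_bitSign,
        sum_mul_bitSign_eq_sum_image M _ hM,
        sum_mul_bitSign_eq_sum_image M' _ hM']
      simp only [sub_mul, Finset.sum_sub_distrib]
      ring)
    (fun h0 => h (funext fun x => sub_eq_zero.1 (congrFun h0 x)))
  simp only [sub_ne_zero] at key
  exact key.trans (Nat.mul_le_mul_right _ hcard)

end Characters

/-! ### Separating points by the probabilistic method. -/

section Separation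

/-- If each of the properties `D p` holds for many points, then some short sequence of points
contains, for each `p`, a point with `D p`. -/
theorem exists_hitting_sequence {ι X : Type*} [Fintype X] (P : Finset ι)
    (D : ι → X → Prop) (s m : ℕ) (hs : 0 < s) [Nonempty X]
    (hD : ∀ p ∈ P, ∀ [DecidablePred (D p)],
      Fintype.card X ≤ s * (Finset.univ.filter (D p)).card)
    (hm : (P.card : ℝ) < Real.exp (m / s)) :
    ∃ Q : Fin m → X, ∀ p ∈ P, ∃ k, D p (Q k) := by
  classical
  by_contra! hcon
  have hX : (0 : ℝ) < Fintype.card X := by exact_mod_cast Fintype.card_pos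
  have hs' : (0 : ℝ) < s := by exact_mod_cast hs
  -- Union bound, in counting form: if no sequence works, the sequences missing some `D p` exhaust
  -- all of them.
  have hsub : (Finset.univ : Finset (Fin m → X)) ⊆
      P.biUnion fun p => Fintype.piFinset fun _ => Finset.univ.filter fun x => ¬ D p x := by
    intro Q _
    obtain ⟨p, hp, hQ⟩ := hcon Q
    simp only [Finset.mem_biUnion, Fintype.mem_piFinset, Finset.mem_filter, Finset.mem_univ,
      true_and]
    exact ⟨p, hp, hQ⟩
  have hcount : (Fintype.card X : ℝ) ^ m ≤
      ∑ p ∈ P, ((Finset.univ.filter fun x => ¬ D p x).card : ℝ) ^ m := by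
    have := (Finset.card_le_card hsub).trans Finset.card_biUnion_le
    simp only [Finset.card_univ, Fintype.card_fun, Fintype.card_fin, Fintype.card_piFinset,
      Finset.prod_const] at this
    exact_mod_cast this
  -- One point misses `D p` with probability at most `1 - 1 / s ≤ exp (-1 / s)`.
  have hone : ∀ p ∈ P, ((Finset.univ.filter fun x => ¬ D p x).card : ℝ) ^ m ≤
      (Fintype.card X : ℝ) ^ m * Real.exp (-(m / s)) := by
    intro p hp
    have h1 : ((Finset.univ.filter (D p)).card : ℝ) +
        (Finset.univ.filter fun x => ¬ D p x).card = Fintype.card X := by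
      exact_mod_cast Finset.card_filter_add_card_filter_not (s := Finset.univ) (D p)
    have h2 : (Fintype.card X : ℝ) ≤ s * (Finset.univ.filter (D p)).card := by
      exact_mod_cast hD p hp
    have h3 : ((Finset.univ.filter fun x => ¬ D p x).card : ℝ) ≤
        Fintype.card X * Real.exp (-(1 / s)) := by
      calc ((Finset.univ.filter fun x => ¬ D p x).card : ℝ)
          ≤ Fintype.card X - Fintype.card X / s := by
            have : (Fintype.card X : ℝ) / s ≤ (Finset.univ.filter (D p)).card := by
              rw [div_le_iff₀ hs']; linarith
            linarith
        _ = Fintype.card X * (-(1 / s) + 1) := by ring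
        _ ≤ _ := mul_le_mul_of_nonneg_left (Real.add_one_le_exp _) hX.le
    calc ((Finset.univ.filter fun x => ¬ D p x).card : ℝ) ^ m
        ≤ (Fintype.card X * Real.exp (-(1 / s))) ^ m :=
          pow_le_pow_left₀ (Nat.cast_nonneg _) h3 m
      _ = _ := by
          rw [mul_pow, ← Real.exp_nat_mul]
          congr 2
          ring
  have hfin : (Fintype.card X : ℝ) ^ m ≤
      P.card * ((Fintype.card X : ℝ) ^ m * Real.exp (-(m / s))) := by
    refine hcount.trans ((Finset.sum_le_sum hone).trans ?_)
    rw [Finset.sum_const, nsmul_eq_mul]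
  have hlt : P.card * ((Fintype.card X : ℝ) ^ m * Real.exp (-(m / s))) <
      Real.exp (m / s) * ((Fintype.card X : ℝ) ^ m * Real.exp (-(m / s))) :=
    mul_lt_mul_of_pos_right hm (by positivity)
  have heq : Real.exp (m / s) * ((Fintype.card X : ℝ) ^ m * Real.exp (-(m / s))) =
      (Fintype.card X : ℝ) ^ m := by
    rw [mul_left_comm, ← Real.exp_add, add_neg_cancel, Real.exp_zero, mul_one]
  linarith

/-- Some `8 * n ^ 3` points determine each function of the form `x ↦ oneMax (M x + b)`. -/
theorem exists_separating_points {n : ℕ} (hn : 1 ≤ n) :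
    ∃ Q : Fin (8 * n ^ 3) → BitVector n, ∀ M b M' b',
      (∀ k, affineOneMax M b (Q k) = affineOneMax M' b' (Q k)) →
        affineOneMax M b = affineOneMax M' b' := by
  classical
  let P : Finset ((Matrix (Fin n) (Fin n) (ZMod 2) × BitVector n) ×
      (Matrix (Fin n) (Fin n) (ZMod 2) × BitVector n)) :=
    Finset.univ.filter fun p => affineOneMax p.1.1 p.1.2 ≠ affineOneMax p.2.1 p.2.2
  have hP : P.card ≤ 2 ^ (4 * n ^ 2) := by
    calc P.card ≤ _ := Finset.card_le_univ _
      _ = 2 ^ (2 * (n * n + n)) := by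
          have hM : Fintype.card (Matrix (Fin n) (Fin n) (ZMod 2)) = 2 ^ (n * n) := by
            rw [← Nat.card_eq_fintype_card, Matrix, Nat.card_fun, Nat.card_fun]
            simp [pow_mul]
          simp only [Fintype.card_prod, hM, Fintype.card_fun, ZMod.card, Fintype.card_fin]
          ring
      _ ≤ _ := Nat.pow_le_pow_right two_pos (by nlinarith)
  have hexp : (P.card : ℝ) < Real.exp ((8 * n ^ 3 : ℕ) / (2 * n : ℕ)) := by
    have hn' : (0 : ℝ) < n := by exact_mod_cast hn
    -- The number `8 * n ^ 3` is chosen so that the exponent `4 * n ^ 2` matches that of the pair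
    -- count; `2 < e` then gives strict inequality.
    have h1 : ((8 * n ^ 3 : ℕ) : ℝ) / (2 * n : ℕ) = (4 * n ^ 2 : ℕ) * 1 := by
      push_cast
      field_simp
      ring
    rw [h1, Real.exp_nat_mul]
    calc (P.card : ℝ) ≤ 2 ^ (4 * n ^ 2) := by exact_mod_cast hP
      _ < Real.exp 1 ^ (4 * n ^ 2) :=
        pow_lt_pow_left₀ (by linarith [Real.exp_one_gt_d9]) (by norm_num) (by positivity)
  obtain ⟨Q, hQ⟩ := exists_hitting_sequence P
    (fun p x => affineOneMax p.1.1 p.1.2 x ≠ affineOneMax p.2.1 p.2.2 x) (2 * n) (8 * n ^ 3)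
    (by omega) (fun p hp _ => by
      have := two_pow_le_card_affineOneMax_ne (Finset.mem_filter.1 hp).2
      simp only [Fintype.card_fun, ZMod.card, Fintype.card_fin]
      convert this) hexp
  refine ⟨Q, fun M b M' b' h => by_contra fun hne => ?_⟩
  obtain ⟨k, hk⟩ := hQ ((M, b), (M', b')) (Finset.mem_filter.2 ⟨Finset.mem_univ _, hne⟩)
  exact hk (h k)

theorem blackBoxComplexity_le_cubic {n : ℕ} (hn : 1 ≤ n) (t : ℕ) :
    blackBoxComplexity (tsAffineOneMax n t) ≤ ((8 * n ^ 3 + 1 : ℕ) : ℝ≥0∞) := by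
  obtain ⟨Q, hQ⟩ := exists_separating_points hn
  refine blackBoxComplexity_le_add (fun k => if hk : k < 8 * n ^ 3 then Q ⟨k, hk⟩ else 0) _ _ ?_
  rintro f ⟨M, -, b, rfl⟩
  obtain ⟨z, hz⟩ := Finite.exists_max (affineOneMax M b)
  -- The function is now known, so a single candidate suffices.
  refine ⟨fun _ => z, ?_⟩
  rintro g ⟨M', -, b', rfl⟩ hfg
  refine ⟨0, one_pos, ?_⟩
  have : affineOneMax M b = affineOneMax M' b' := hQ _ _ _ _ fun k => by
    simpa only [affineOneMax, k.2, dif_pos] using hfg k k.2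
  change ∀ y, affineOneMax M' b' y ≤ affineOneMax M' b' z
  rw [← this]
  exact hz

end Separation

/-! ### The linear bound for one transvection. -/

section SingleTransvection

variable {n : ℕ}

/-- The value of the bit as a real number flips sign around one half when the bit flips. -/
theorem val_add_one_eq (u : ZMod 2) : ((u + 1).val : ℝ) = 1 - u.val := by
  rw [val_eq_bitSign, val_eq_bitSign, bitSign_add, bitSign_one]
  ring

theorem oneMax_single_add (k : Fin n) (b : BitVector n) :
    oneMax (Pi.single k 1 + b) = oneMax b + (1 - 2 * (b k).val) := by
  rw [oneMax, oneMax, ← Finset.add_sum_erase _ _ (Finset.mem_univ k),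
    ← Finset.add_sum_erase (a := k) (f := fun i => ((b i).val : ℝ)) _ (Finset.mem_univ k)]
  have : ∀ i ∈ Finset.univ.erase k,
      (((Pi.single k 1 + b : BitVector n) i).val : ℝ) = (b i).val := by
    intro i hi
    simp [Finset.ne_of_mem_erase hi]
  rw [Finset.sum_congr rfl this]
  simp only [Pi.add_apply, Pi.single_eq_same, add_comm (1 : ZMod 2), val_add_one_eq]
  ring

theorem transvection_mulVec_single_of_ne {i j k : Fin n} (h : k ≠ j) :
    Matrix.transvection i j (1 : ZMod 2) *ᵥ Pi.single k 1 = Pi.single k 1 := by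
  rw [Matrix.transvection, Matrix.add_mulVec, Matrix.one_mulVec, Matrix.single_mulVec,
    Pi.single_eq_of_ne h.symm, mul_zero]
  exact (congrArg _ (Pi.single_zero i)).trans (add_zero _)

theorem transvection_mulVec_single_self (i j : Fin n) :
    Matrix.transvection i j (1 : ZMod 2) *ᵥ Pi.single j 1 = Pi.single i 1 + Pi.single j 1 := by
  rw [Matrix.transvection, Matrix.add_mulVec, Matrix.one_mulVec, Matrix.single_mulVec,
    Pi.single_eq_same, mul_one, add_comm]
  rfl

theorem affineOneMax_zero (M : Matrix (Fin n) (Fin n) (ZMod 2)) (b : BitVector n) :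
    affineOneMax M b 0 = oneMax b := by
  simp [affineOneMax]

theorem affineOneMax_transvection_single_of_ne {i j k : Fin n} (h : k ≠ j) (b : BitVector n) :
    affineOneMax (Matrix.transvection i j 1) b (Pi.single k 1) =
      oneMax b + (1 - 2 * (b k).val) := by
  rw [affineOneMax, transvection_mulVec_single_of_ne h, oneMax_single_add]

theorem affineOneMax_transvection_single_self {i j : Fin n} (h : i ≠ j) (b : BitVector n) :
    affineOneMax (Matrix.transvection i j 1) b (Pi.single j 1) =
      oneMax b + (2 - 2 * (b i).val - 2 * (b j).val) := by
  rw [affineOneMax, transvection_mulVec_single_self, add_assoc, oneMax_single_add,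
    oneMax_single_add, Pi.add_apply, Pi.single_eq_of_ne h, zero_add]
  ring

/-- The values at `0` and at the unit vectors determine the second index and the translation. -/
theorem eq_of_affineOneMax_transvection_eq {i j i' j' : Fin n} {b b' : BitVector n}
    (hij : i ≠ j) (hij' : i' ≠ j')
    (h0 : affineOneMax (Matrix.transvection i j 1) b 0 =
      affineOneMax (Matrix.transvection i' j' 1) b' 0)
    (h1 : ∀ k, affineOneMax (Matrix.transvection i j 1) b (Pi.single k 1) =
      affineOneMax (Matrix.transvection i' j' 1) b' (Pi.single k 1)) :
    j = j' ∧ b = b' := by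
  rw [affineOneMax_zero, affineOneMax_zero] at h0
  have hj : j = j' := by
    by_contra hne
    have h := h1 j
    rw [affineOneMax_transvection_single_self hij,
      affineOneMax_transvection_single_of_ne hne, h0, add_right_inj] at h
    -- Parity: relative to the value at `0`, the increment at a unit vector is even exactly at the
    -- second index of the transvection.
    have h' : (2 - 2 * ((b i).val : ℤ) - 2 * (b j).val) = 1 - 2 * (b' j).val := by
      exact_mod_cast h
    omega
  subst hj
  have hb : ∀ k, k ≠ j → b k = b' k := fun k hk => by
    have h := h1 k
    rw [affineOneMax_transvection_single_of_ne hk, affineOneMax_transvection_single_of_ne hk, h0,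
      add_right_inj] at h
    apply ZMod.val_injective 2
    have h' : (1 - 2 * ((b k).val : ℤ)) = 1 - 2 * (b' k).val := by exact_mod_cast h
    omega
  refine ⟨rfl, funext fun k => ?_⟩
  by_cases hk : k = j
  · subst hk
    -- The remaining bit `b j` follows from the total `oneMax b`, the value at `0`.
    rw [oneMax, oneMax, ← Finset.add_sum_erase _ _ (Finset.mem_univ k),
      ← Finset.add_sum_erase (a := k) (f := fun i => ((b' i).val : ℝ)) _ (Finset.mem_univ k),
      Finset.sum_congr rfl fun l hl => by rw [hb l (Finset.ne_of_mem_erase hl)],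
      add_left_inj] at h0
    exact ZMod.val_injective 2 (by exact_mod_cast h0)
  · exact hb k hk

theorem mem_transvectionProducts_one {M : Matrix (Fin n) (Fin n) (ZMod 2)}
    (h : M ∈ transvectionProducts n 1) : ∃ i j, i ≠ j ∧ M = Matrix.transvection i j 1 := by
  obtain ⟨L, hL, hτ, rfl⟩ := h
  obtain ⟨τ, rfl⟩ := List.length_eq_one_iff.1 hL
  simpa using hτ τ (by simp)

theorem blackBoxComplexity_one_le (n : ℕ) :
    blackBoxComplexity (tsAffineOneMax n 1) ≤ ((n + 1 + n : ℕ) : ℝ≥0∞) := by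
  refine blackBoxComplexity_le_add
    -- Index `n` is the query at `0`, so the first phase has `n + 1` points.
    (fun k => if hk : k < n then Pi.single ⟨k, hk⟩ 1 else 0) _ _ ?_
  rintro f ⟨M, hM, b, rfl⟩
  obtain ⟨i, j, hij, rfl⟩ := mem_transvectionProducts_one hM
  choose z hz using fun l : Fin n => Finite.exists_max (affineOneMax (Matrix.transvection l j 1) b)
  refine ⟨fun k => if hk : k < n then z ⟨k, hk⟩ else 0, ?_⟩
  rintro g ⟨M', hM', b', rfl⟩ hfg
  obtain ⟨i', j', hij', rfl⟩ := mem_transvectionProducts_one hM'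
  obtain ⟨rfl, rfl⟩ := eq_of_affineOneMax_transvection_eq (b := b) (b' := b') hij hij'
    (by simpa [affineOneMax] using hfg n (by omega))
    (fun k => by simpa [affineOneMax] using hfg k (by omega))
  refine ⟨i', i'.2, ?_⟩
  simpa [affineOneMax] using hz i'

end SingleTransvection

theorem mainTheorem6 :
    ∃ (C : ℝ) (N : ℕ), ∀ t : ℕ, 1 ≤ t → ∀ n : ℕ, N ≤ n →
      (t ≤ 5 →
        blackBoxComplexity (tsAffineOneMax n t) ≤ ENNReal.ofReal (C * (n : ℝ) ^ (2 * t - 1))) ∧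
      (5 < t →
        blackBoxComplexity (tsAffineOneMax n t) ≤
          ENNReal.ofReal (C * ((n : ℝ) ^ 10 * Real.log n ^ 2))) := by
  -- `9` absorbs `8 * n ^ 3 + 1` and `2 * n + 1`; `n ≥ 3 > e` ensures `log n ≥ 1`.
  refine ⟨9, 3, fun t ht n hn => ?_⟩
  have hn1 : (1 : ℝ) ≤ n := by exact_mod_cast (by omega : 1 ≤ n)
  have hle {B : ℕ} {R : ℝ} (hB : blackBoxComplexity (tsAffineOneMax n t) ≤ (B : ℝ≥0∞))
      (hR : (B : ℝ) ≤ R) : blackBoxComplexity (tsAffineOneMax n t) ≤ ENNReal.ofReal R := by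
    refine hB.trans ?_
    rw [← ENNReal.ofReal_natCast]
    exact ENNReal.ofReal_le_ofReal hR
  have hcubic : ((8 * n ^ 3 + 1 : ℕ) : ℝ) ≤ 9 * (n : ℝ) ^ 3 := by
    push_cast
    linarith [one_le_pow₀ hn1 (n := 3)]
  constructor
  · intro _
    rcases ht.eq_or_lt with rfl | ht2
    · refine hle (blackBoxComplexity_one_le n) ?_
      push_cast
      norm_num
      linarith
    · refine hle (blackBoxComplexity_le_cubic (by omega) t) (hcubic.trans ?_)
      gcongr
      omega
  · intro _
    refine hle (blackBoxComplexity_le_cubic (by omega) t) (hcubic.trans ?_)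
    have hlog : 1 ≤ Real.log n := by
      rw [Real.le_log_iff_exp_le (by linarith)]
      have : (3 : ℝ) ≤ n := by exact_mod_cast hn
      linarith [Real.exp_one_lt_d9]
    have h1 : (n : ℝ) ^ 3 ≤ (n : ℝ) ^ 10 := pow_le_pow_right₀ hn1 (by norm_num)
    have h2 : (n : ℝ) ^ 10 ≤ (n : ℝ) ^ 10 * Real.log n ^ 2 :=
      le_mul_of_one_le_right (by positivity) (one_le_pow₀ hlog)
    linarith
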